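/- Let $\mathcal V$ be a totally ordered set and let $n\ge 0$. Consider an asynchronous system of a set $V$ of $n$ identical, anonymous, deterministic agents with a complete topology. Each agent $u$ has an input value $\mu_u\in\mathcal V$ and an output variable $y_u$ initialized to $\mu_u$. In a run, agents take atomic steps in an arbitrary order and at arbitrary relative speeds; in a step an agent receives at most one message, updates its state by a deterministic rule which is the same for all agents and does not involve any identifiers, and sends at most one message to all the other agents. An agent that takes only finitely many steps is said to \emph{crash}; an agent \emph{commits a send omission} if in some step it fails to send its message to at least one of the other agents. Links are \emph{reliable}: a received message has previously been sent to the receiver, no message is received twice by the same agent, and every message actually sent to an agent that does not crash is eventually received by it; message delays are finite but unbounded. Then there is an algorithm, which may depend on $n$ and $\mathcal V$, such that in every run in which fewer than $n/2$ agents crash or commit send omissions (or both), and for all input values $(\mu_u)_{u\in V}$, stabilizing consensus is achieved, i.e.: 1. (Validity) at every time $t$ and for every agent $u$, there is an agent $v$ with $y_u(t)=\mu_v$; 2. (Eventual agreement) there is a time $s$ such that $y_v(t)=y_u(s)$ for all $t\ge s$ and all agents $u,v$ that do not crash (including those that commit send omissions). -/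

import Mathlib

universe u

/-- A deterministic algorithm for identical and anonymous agents with values in `𝒱`. All agents
execute the same program, with no access to identifiers (neither their own nor those of the
senders of the messages they receive). In an atomic step an agent receives at most one message,
changes its state, and sends at most one message to all the other agents. -/
structure Algorithm (𝒱 : Type u) where
  /-- local states -/
  State : Type u
  /-- messages -/
  Msg : Type u
  /-- the initial state of an agent with a given input value -/
  init : 𝒱 → State
  /-- the value of the output variable in a given state -/
  output : State → 𝒱
  /-- the output variable is initialized to the input value -/
  output_init : ∀ μ, output (init μ) = μ
  /-- the new state and the message that is broadcast (if any), as a function of the current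
  state and of the message received (if any) -/
  step : State → Option Msg → State × Option Msg

/-- An infinite run of `A` in an asynchronous, completely connected system of `n` agents: at each
time `k` one agent, chosen without any assumption on relative speeds, takes a step. The message
broadcast in step `j` is identified by `j`. The properties of the links are in
`Run.ReliableLinks`, and failures are in `Run.Crashes` and `Run.OmitsSend`. -/
structure Run {𝒱 : Type u} (A : Algorithm 𝒱) (n : ℕ) where
  /-- the input values -/
  input : Fin n → 𝒱
  /-- the agent that takes step `k` -/
  agent : ℕ → Fin n
  /-- the step in which the message received in step `k` was sent; `none` if step `k` receives
  no message -/
  recv : ℕ → Option ℕ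
  /-- the message broadcast in step `k`; `none` if there is no such message -/
  sent : ℕ → Option A.Msg
  /-- the agents `v` such that the message broadcast in step `k` is actually put on the link
  to `v`; its sending to the remaining agents is omitted -/
  emitted : ℕ → Set (Fin n)
  /-- the state of each agent at time `k`, just before step `k` -/
  state : ℕ → Fin n → A.State
  state_zero : ∀ v, state 0 v = A.init (input v)
  state_agent : ∀ k,
    state (k + 1) (agent k) = (A.step (state k (agent k)) ((recv k).bind sent)).1
  sent_eq : ∀ k, sent k = (A.step (state k (agent k)) ((recv k).bind sent)).2
  state_other : ∀ k v, v ≠ agent k → state (k + 1) v = state k v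

namespace Run

variable {𝒱 : Type u} {A : Algorithm 𝒱} {n : ℕ}

/-- The value of the output variable of the agent `v` at time `k`. -/
def y (R : Run A n) (v : Fin n) (k : ℕ) : 𝒱 := A.output (R.state k v)

/-- An agent crashes if it takes only finitely many steps (possibly none). -/
def Crashes (R : Run A n) (v : Fin n) : Prop := {k | R.agent k = v}.Finite

/-- An agent commits a send omission if, in some step, it does not actually send its message to
one of the other agents. -/
def OmitsSend (R : Run A n) (v : Fin n) : Prop :=
  ∃ k, R.agent k = v ∧ (R.sent k).isSome ∧ ∃ w, w ≠ v ∧ w ∉ R.emitted k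

/-- The agents that crash, commit send omissions, or both. -/
def Faulty (R : Run A n) (v : Fin n) : Prop := R.Crashes v ∨ R.OmitsSend v

/-- There is a reliable link from every agent to every other agent. -/
structure ReliableLinks (R : Run A n) : Prop where
  /-- no creation: a received message was previously put by another agent on its link to the
  receiver -/
  no_creation : ∀ j k, R.recv k = some j →
    j < k ∧ R.agent j ≠ R.agent k ∧ (R.sent j).isSome ∧ R.agent k ∈ R.emitted j
  /-- no duplication: an agent does not receive the same message twice -/
  no_duplication : ∀ j k k', R.recv k = some j → R.recv k' = some j →
    R.agent k = R.agent k' → k = k'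
  /-- no loss: a message put on a link to an agent that does not crash is eventually received -/
  no_loss : ∀ j v, (R.sent j).isSome → v ≠ R.agent j → v ∈ R.emitted j → ¬ R.Crashes v →
    ∃ k, R.agent k = v ∧ R.recv k = some j

/-- Less than half of the agents are faulty. -/
def FaultyMinority (R : Run A n) : Prop := 2 * {v | R.Faulty v}.ncard < n

/-- Validity holds at all times for all agents, and all the agents that do not crash (including
those that commit send omissions) eventually agree forever. -/
def AchievesStabilizingConsensus (R : Run A n) : Prop :=
  (∀ k u, ∃ v, R.y u k = R.input v) ∧
  ∃ s, ∀ k, s ≤ k → ∀ u v, ¬ R.Crashes u → ¬ R.Crashes v → R.y v k = R.y u s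

end Run

/-- `A` solves stabilizing consensus in the asynchronous system of `n` agents with complete
topology, reliable links, and a minority of agents that crash or commit send omissions. -/
def Algorithm.SolvesStabilizingConsensus {𝒱 : Type u} (A : Algorithm 𝒱) (n : ℕ) : Prop :=
  ∀ R : Run A n, R.ReliableLinks → R.FaultyMinority → R.AchievesStabilizingConsensus

/-!
# Stabilizing consensus with a minority of crashes and send omissions

The agents proceed in asynchronous rounds. In each positive round an agent broadcasts the least value
`low` it has heard of and the largest `low` that it received in the previous round (`high`). It
enters the next round when it has received messages of the current round from `n / 2` other agents,
and then outputs the largest `high` of the round. As the heard-of sets are majorities, some agent is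
heard of by all others within any two consecutive rounds, and once the `low` values are stable this
agent has the largest one, which therefore is the common output.
-/

/-! The `low` of an agent never increases and is always an input, so it stabilizes, and agents that
crash stop announcing. Hence from some round `r₀` on, every announcement comes from a non-crashing
agent `v` and carries a fixed value `f v` (`exists_stable_round`). The `f v` may differ, since an
agent with a small value may omit all its sends; the outputs settle on the maximum of `f`.

Every agent hears a majority, itself included, and hearing `w` forces `f v ≤ f w`. By double
counting (`exists_popular`) some `p` is heard by a majority `Q`, whose `high` values are then at
least `f p`. In the following round each agent `u` hears some `w ∈ Q`, so `f u ≤ f w ≤ f p` and `u`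
outputs at least `f p`. Thus `f p` is the maximum, although `p` may vary with the round. Conversely,
no stable `low`, hence no later `high` or output, exceeds the maximum (`exists_common_out`). Rounds
never block, as the non-faulty agents form a majority (`exists_le_round`). -/

namespace MinMax

/-! ### Folds of minima and maxima, and a counting argument -/

section ListFold

variable {α : Type*} [LinearOrder α]

theorem foldr_min_le_init (a : α) (l : List α) : l.foldr min a ≤ a := by
  induction l with
  | nil => exact le_rfl
  | cons b l ih => exact (min_le_right _ _).trans ih

theorem foldr_min_le_of_mem (a : α) {l : List α} {b : α} (hb : b ∈ l) : l.foldr min a ≤ b := by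
  induction l with
  | nil => simp at hb
  | cons c l ih =>
    rcases List.mem_cons.1 hb with rfl | hb
    · exact min_le_left _ _
    · exact (min_le_right _ _).trans (ih hb)

theorem le_foldr_max_init (a : α) (l : List α) : a ≤ l.foldr max a :=
  foldr_min_le_init (α := αᵒᵈ) a l

theorem le_foldr_max_of_mem (a : α) {l : List α} {b : α} (hb : b ∈ l) : b ≤ l.foldr max a :=
  foldr_min_le_of_mem (α := αᵒᵈ) a hb

/-- In a linear order the fold is either the seed or an entry of the list. -/
theorem foldr_min_induction {p : α → Prop} {a : α} {l : List α} (ha : p a) (hl : ∀ b ∈ l, p b) :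
    p (l.foldr min a) := by
  induction l with
  | nil => exact ha
  | cons b l ih =>
    have h1 := hl b (by simp)
    have h2 := ih fun c hc => hl c (by simp [hc])
    rcases min_choice b (l.foldr min a) with h | h <;> simpa [h]

theorem foldr_max_induction {p : α → Prop} {a : α} {l : List α} (ha : p a) (hl : ∀ b ∈ l, p b) :
    p (l.foldr max a) :=
  foldr_min_induction (α := αᵒᵈ) (p := p) ha hl

/-- An antitone sequence with finitely many values is eventually constant. -/
theorem eventually_const_of_antitone {f : ℕ → α} (hf : Antitone f) (hfin : (Set.range f).Finite) :
    ∃ s, ∀ k, s ≤ k → f k = f s := by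
  obtain ⟨_, ⟨s, rfl⟩, hs⟩ := hfin.exists_minimal (Set.range_nonempty f)
  exact ⟨s, fun k hk => le_antisymm (hf hk) (hs ⟨k, rfl⟩ (hf hk))⟩

end ListFold

/-- If each member of a nonempty finite set `N` has chosen at least `K` members of `N`, then some
member of `N` was chosen by at least `K` members. -/
theorem exists_popular {α : Type*} [DecidableEq α] {N : Finset α} (hN : N.Nonempty) {K : ℕ}
    {H : α → Finset α} (hsub : ∀ u ∈ N, H u ⊆ N) (hcard : ∀ u ∈ N, K ≤ (H u).card) :
    ∃ p ∈ N, K ≤ (N.filter fun u => p ∈ H u).card := by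
  refine Finset.exists_le_of_sum_le hN ?_
  -- Count the pairs (chooser, chosen) both ways: the average in-degree is at least `K`.
  have h := Finset.sum_card_bipartiteAbove_eq_sum_card_bipartiteBelow (s := N) (t := N)
    (fun u p => p ∈ H u)
  simp only [Finset.bipartiteAbove, Finset.bipartiteBelow] at h
  rw [← h]
  refine Finset.sum_le_sum fun u hu => (hcard u hu).trans (Finset.card_le_card fun p hp => ?_)
  exact Finset.mem_filter.2 ⟨hsub u hu hp, hp⟩

/-! ### The min-max algorithm -/

/-- The message broadcast by an agent that enters a round. -/
structure Message (𝒱 : Type u) where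
  /-- the round that is entered -/
  round : ℕ
  /-- the least value heard of -/
  low : 𝒱
  /-- the largest `low` received in the preceding round -/
  high : 𝒱

/-- The local states of the min-max algorithm. -/
structure LocalState (𝒱 : Type u) where
  /-- the current round -/
  round : ℕ
  /-- the least value heard of -/
  low : 𝒱
  /-- the largest `low` received in the preceding round -/
  high : 𝒱
  /-- the output variable -/
  out : 𝒱
  /-- all the messages received so far -/
  inbox : List (Message 𝒱)

variable {𝒱 : Type u} [LinearOrder 𝒱] {n : ℕ}

/-- The received messages of the current round. -/
def LocalState.current (s : LocalState 𝒱) : List (Message 𝒱) :=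
  s.inbox.filter fun msg => msg.round = s.round

/-- The state after the reception of a message. -/
def LocalState.receive (s : LocalState 𝒱) (o : Option (Message 𝒱)) : LocalState 𝒱 :=
  { s with inbox := o.toList ++ s.inbox }

/-- The state after entering the next round. -/
def LocalState.advance (s : LocalState 𝒱) : LocalState 𝒱 where
  round := s.round + 1
  low := (s.current.map Message.low).foldr min s.low
  high := (s.current.map Message.low).foldr max s.low
  out := (s.current.map Message.high).foldr max s.high
  inbox := s.inbox

/-- The message announcing the current round. -/
def LocalState.announcement (s : LocalState 𝒱) : Message 𝒱 := ⟨s.round, s.low, s.high⟩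

/-- An agent is ready for the next round when it has got `n / 2` messages of the current one. -/
def LocalState.Ready (n : ℕ) (s : LocalState 𝒱) : Prop :=
  -- Round 0 is never announced, so waiting for its messages would block forever.
  s.round = 0 ∨ n / 2 ≤ s.current.length

open Classical in
/-- The min-max algorithm for `n` agents. -/
noncomputable def algorithm (𝒱 : Type u) [LinearOrder 𝒱] (n : ℕ) : Algorithm 𝒱 where
  State := LocalState 𝒱
  Msg := Message 𝒱
  init μ := ⟨0, μ, μ, μ, []⟩
  output s := s.out
  output_init _ := rfl
  step s o :=
    if (s.receive o).Ready n then
      ((s.receive o).advance, some (s.receive o).advance.announcement)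
    else (s.receive o, none)

/-! ### Steps, rounds and announcements in a run -/

variable (R : Run (algorithm 𝒱 n) n)

/-- The local state of an agent. -/
def st (k : ℕ) (v : Fin n) : LocalState 𝒱 := R.state k v

/-- The message broadcast in a step. -/
def snd (k : ℕ) : Option (Message 𝒱) := R.sent k

/-- The state of the active agent in step `k` between the reception and the local computation. -/
def mid (k : ℕ) : LocalState 𝒱 := (st R k (R.agent k)).receive ((R.recv k).bind (snd R))

theorem st_zero (v : Fin n) : st R 0 v = ⟨0, R.input v, R.input v, R.input v, []⟩ :=
  R.state_zero v

theorem st_of_ne {k : ℕ} {v : Fin n} (h : R.agent k ≠ v) : st R (k + 1) v = st R k v :=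
  R.state_other k v h.symm

theorem step_cases (k : ℕ) :
    ((mid R k).Ready n ∧ st R (k + 1) (R.agent k) = (mid R k).advance ∧
      snd R k = some (mid R k).advance.announcement) ∨
    (¬ (mid R k).Ready n ∧ st R (k + 1) (R.agent k) = mid R k ∧ snd R k = none) := by
  have h1 : st R (k + 1) (R.agent k) = _ := R.state_agent k
  have h2 : snd R k = _ := R.sent_eq k
  by_cases h : (mid R k).Ready n
  · refine Or.inl ⟨h, h1.trans ?_, h2.trans ?_⟩
    · exact congrArg Prod.fst (if_pos h)
    · exact congrArg Prod.snd (if_pos h)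
  · refine Or.inr ⟨h, h1.trans ?_, h2.trans ?_⟩
    · exact congrArg Prod.fst (if_neg h)
    · exact congrArg Prod.snd (if_neg h)

theorem ready_of_snd {k : ℕ} {msg : Message 𝒱} (h : snd R k = some msg) :
    (mid R k).Ready n ∧ st R (k + 1) (R.agent k) = (mid R k).advance ∧
      msg = (st R (k + 1) (R.agent k)).announcement := by
  rcases step_cases R k with ⟨h1, h2, h3⟩ | ⟨-, -, h3⟩
  · exact ⟨h1, h2, by rw [h2]; simpa using h.symm.trans h3⟩
  · rw [h] at h3; cases h3

theorem round_succ (k : ℕ) (v : Fin n) :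
    (st R (k + 1) v).round = (st R k v).round ∨
    ((st R (k + 1) v).round = (st R k v).round + 1 ∧ R.agent k = v ∧
      snd R k = some (st R (k + 1) v).announcement) := by
  by_cases hv : R.agent k = v
  · subst hv
    rcases step_cases R k with ⟨-, h2, h3⟩ | ⟨-, h2, -⟩
    · exact Or.inr ⟨by rw [h2]; rfl, rfl, by rw [h2, h3]⟩
    · exact Or.inl (by rw [h2]; rfl)
  · exact Or.inl (by rw [st_of_ne R hv])

theorem round_mono (v : Fin n) : Monotone fun k => (st R k v).round :=
  monotone_nat_of_le_succ fun k => by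
    rcases round_succ R k v with h | ⟨h, -⟩ <;> simp only [h] <;> omega

theorem low_antitone (v : Fin n) : Antitone fun k => (st R k v).low := by
  refine antitone_nat_of_succ_le fun k => ?_
  by_cases hv : R.agent k = v
  · subst hv
    rcases step_cases R k with ⟨-, h2, -⟩ | ⟨-, h2, -⟩
    · simp only [h2]; exact foldr_min_le_init _ _
    · simp only [h2]; exact le_rfl
  · simp only [st_of_ne R hv]; exact le_rfl

theorem round_of_snd {k : ℕ} {msg : Message 𝒱} (h : snd R k = some msg) :
    msg.round = (st R k (R.agent k)).round + 1 := by
  obtain ⟨-, h2, h3⟩ := ready_of_snd R h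
  rw [h3, h2]; rfl

theorem round_succ_of_snd {k : ℕ} {msg : Message 𝒱} (h : snd R k = some msg) :
    (st R (k + 1) (R.agent k)).round = msg.round := by
  obtain ⟨-, -, h3⟩ := ready_of_snd R h
  rw [h3]; rfl

/-- Every broadcast moves its sender up to the announced round, and rounds never decrease. -/
theorem snd_unique {j k : ℕ} {a b : Message 𝒱} (ha : snd R j = some a) (hb : snd R k = some b)
    (hr : a.round = b.round) (hv : R.agent j = R.agent k) : j = k := by
  wlog hlt : j < k generalizing j k a b
  · by_contra hne
    exact hne (this hb ha hr.symm hv.symm (by omega)).symm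
  have h1 := round_succ_of_snd R ha
  have h2 := round_of_snd R hb
  have h3 := round_mono R (R.agent j) (show j + 1 ≤ k from hlt)
  simp only [hv] at h1 h3
  omega

/-- An agent in round `≥ r` has announced round `r`. -/
theorem exists_snd_of_le_round {v : Fin n} {r k : ℕ} (hr : 1 ≤ r) (h : r ≤ (st R k v).round) :
    ∃ j < k, R.agent j = v ∧ ∃ msg, snd R j = some msg ∧ msg.round = r := by
  induction k with
  | zero => rw [st_zero] at h; simp at h; omega
  | succ k ih =>
    by_cases hk : r ≤ (st R k v).round
    · obtain ⟨j, hj, h'⟩ := ih hk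
      exact ⟨j, by omega, h'⟩
    · rcases round_succ R k v with h1 | ⟨h1, h2, h3⟩
      · omega
      · exact ⟨k, by omega, h2, _, h3, show (st R (k + 1) v).round = r by omega⟩

/-- Apart from the inbox, the state is the one that the latest announcement left. -/
theorem exists_latest_snd {v : Fin n} {k : ℕ} (h : 1 ≤ (st R k v).round) :
    ∃ j < k, R.agent j = v ∧ snd R j = some (st R k v).announcement ∧
      (st R k v).out = (st R (j + 1) v).out := by
  induction k with
  | zero => rw [st_zero] at h; simp at h
  | succ k ih =>
    by_cases hv : R.agent k = v
    · subst hv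
      rcases step_cases R k with ⟨-, h2, h3⟩ | ⟨-, h2, -⟩
      · exact ⟨k, by omega, rfl, by rw [h2, h3], rfl⟩
      · rw [h2] at h ⊢
        obtain ⟨j, hj, h4⟩ := ih h
        exact ⟨j, by omega, h4⟩
    · rw [st_of_ne R hv] at h ⊢
      obtain ⟨j, hj, h4⟩ := ih h
      exact ⟨j, by omega, h4⟩

/-! ### Received messages and their senders -/

/-- `v` has received the message of step `j` before time `k`. -/
def Got (v : Fin n) (k j : ℕ) : Prop := ∃ i < k, R.agent i = v ∧ R.recv i = some j

variable {R}

/-- Messages are anonymous and may have equal contents; indexing them by their sending steps,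
distinct by `no_duplication`, is what allows counting senders. -/
theorem exists_inbox_indices (hR : R.ReliableLinks) (v : Fin n) (k : ℕ) :
    ∃ l : List ℕ, l.Nodup ∧ (st R k v).inbox = l.filterMap (snd R) ∧
      ∀ j, j ∈ l ↔ Got R v k j := by
  induction k with
  | zero => exact ⟨[], by simp, by simp [st_zero], by simp [Got]⟩
  | succ k ih =>
    obtain ⟨l, hl, hin, hmem⟩ := ih
    by_cases hv : R.agent k = v
    · have hbox : (st R (k + 1) v).inbox =
          ((R.recv k).bind (snd R)).toList ++ (st R k v).inbox := by
        subst hv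
        rcases step_cases R k with ⟨-, h2, -⟩ | ⟨-, h2, -⟩ <;> rw [h2] <;> rfl
      rcases hr : R.recv k with _ | j
      · refine ⟨l, hl, by simp [hbox, hr, hin], fun i => (hmem i).trans ?_⟩
        constructor
        · rintro ⟨t, ht, h⟩; exact ⟨t, by omega, h⟩
        · rintro ⟨t, ht, h, h'⟩
          refine ⟨t, lt_of_le_of_ne (by omega) ?_, h, h'⟩
          rintro rfl; rw [hr] at h'; cases h'
      · refine ⟨j :: l, List.nodup_cons.2 ⟨?_, hl⟩, ?_, fun i => ?_⟩
        · intro hj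
          obtain ⟨t, ht, h, h'⟩ := (hmem j).1 hj
          exact ht.ne (hR.no_duplication j t k h' hr (h.trans hv.symm))
        · rw [hbox, hr, hin]
          rcases hs : snd R j with _ | msg <;> simp [hs]
        · rw [List.mem_cons, hmem]
          constructor
          · rintro (rfl | ⟨t, ht, h⟩)
            · exact ⟨k, by omega, hv, hr⟩
            · exact ⟨t, by omega, h⟩
          · rintro ⟨t, ht, h, h'⟩
            rcases (Nat.lt_succ_iff_lt_or_eq.1 ht) with ht | rfl
            · exact Or.inr ⟨t, ht, h, h'⟩
            · rw [hr] at h'; exact Or.inl (Option.some.inj h').symm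
    · rw [st_of_ne R hv]
      refine ⟨l, hl, hin, fun i => (hmem i).trans ?_⟩
      constructor
      · rintro ⟨t, ht, h⟩; exact ⟨t, by omega, h⟩
      · rintro ⟨t, ht, h, h'⟩
        refine ⟨t, lt_of_le_of_ne (by omega) ?_, h, h'⟩
        rintro rfl; exact hv h

theorem mem_inbox (hR : R.ReliableLinks) {v : Fin n} {k : ℕ} {msg : Message 𝒱} :
    msg ∈ (st R k v).inbox ↔ ∃ j, Got R v k j ∧ snd R j = some msg := by
  obtain ⟨l, -, hin, hmem⟩ := exists_inbox_indices hR v k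
  simp [hin, hmem]

variable (R) in
open Classical in
/-- The other agents whose messages of round `r` were received by `v` before time `k`. -/
noncomputable def senders (v : Fin n) (k r : ℕ) : Finset (Fin n) :=
  Finset.univ.filter fun w => ∃ j, Got R v k j ∧ R.agent j = w ∧
    ∃ msg, snd R j = some msg ∧ msg.round = r

theorem mem_senders {v w : Fin n} {k r : ℕ} : w ∈ senders R v k r ↔
    ∃ j, Got R v k j ∧ R.agent j = w ∧ ∃ msg, snd R j = some msg ∧ msg.round = r := by
  simp [senders]

/-- As an agent announces a round only once, counting messages is counting senders. -/
theorem length_filter_inbox (hR : R.ReliableLinks) (v : Fin n) (k r : ℕ) :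
    ((st R k v).inbox.filter fun msg => msg.round = r).length = (senders R v k r).card := by
  classical
  obtain ⟨l, hl, hin, hmem⟩ := exists_inbox_indices hR v k
  let p : ℕ → Prop := fun j => ∃ msg, snd R j = some msg ∧ msg.round = r
  have h1 : ((st R k v).inbox.filter fun msg => msg.round = r).length =
      (l.filter fun j => p j).length := by
    rw [hin]
    clear hl hin hmem
    induction l with
    | nil => rfl
    | cons j l ih =>
      rcases hs : snd R j with _ | msg
      · simp [hs, ih, p]
      · by_cases hm : msg.round = r <;> simp [hs, hm, ih, p]
  have h2 : senders R v k r = (l.filter fun j => p j).toFinset.image R.agent := by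
    ext w
    simp only [mem_senders, Finset.mem_image, List.mem_toFinset, List.mem_filter, hmem, p,
      decide_eq_true_eq]
    constructor
    · rintro ⟨j, h, h', h''⟩; exact ⟨j, ⟨h, h''⟩, h'⟩
    · rintro ⟨j, ⟨h, h''⟩, h'⟩; exact ⟨j, h, h', h''⟩
  rw [h1, h2, Finset.card_image_of_injOn, List.toFinset_card_of_nodup (hl.filter _)]
  intro i hi j hj hij
  simp only [Finset.mem_coe, List.mem_toFinset, List.mem_filter, p, decide_eq_true_eq] at hi hj
  obtain ⟨-, a, ha, ha'⟩ := hi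
  obtain ⟨-, b, hb, hb'⟩ := hj
  exact snd_unique R ha hb (ha'.trans hb'.symm) hij

theorem mid_inbox (k : ℕ) : (mid R k).inbox = (st R (k + 1) (R.agent k)).inbox := by
  rcases step_cases R k with ⟨-, h2, -⟩ | ⟨-, h2, -⟩ <;> rw [h2] <;> rfl

/-- Time `k + 1` includes the message received in step `k`; the round is read before any advance. -/
theorem length_current_mid (hR : R.ReliableLinks) (k : ℕ) : (mid R k).current.length =
    (senders R (R.agent k) (k + 1) (st R k (R.agent k)).round).card := by
  rw [← length_filter_inbox hR, ← mid_inbox]; rfl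

theorem mem_current_mid (hR : R.ReliableLinks) {k : ℕ} {msg : Message 𝒱} :
    msg ∈ (mid R k).current ↔ (∃ j, Got R (R.agent k) (k + 1) j ∧ snd R j = some msg) ∧
      msg.round = (st R k (R.agent k)).round := by
  rw [← mem_inbox hR, ← mid_inbox]
  simp only [LocalState.current, List.mem_filter, decide_eq_true_eq]
  rfl

/-! ### Validity -/

/-- All the values in a local state are input values. -/
theorem values_mem_range (hR : R.ReliableLinks) (k : ℕ) (v : Fin n) :
    (st R k v).low ∈ Set.range R.input ∧ (st R k v).high ∈ Set.range R.input ∧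
      (st R k v).out ∈ Set.range R.input := by
  induction k using Nat.strong_induction_on generalizing v with
  | _ k ih =>
    rcases k with _ | k
    · simp [st_zero]
    · by_cases hv : R.agent k = v
      · subst hv
        have hk := ih k (by omega) (R.agent k)
        rcases step_cases R k with ⟨-, h2, -⟩ | ⟨-, h2, -⟩
        · have hcur : ∀ msg ∈ (mid R k).current,
              msg.low ∈ Set.range R.input ∧ msg.high ∈ Set.range R.input := by
            intro msg hmsg
            obtain ⟨⟨j, ⟨i, hi, -, hij⟩, hj⟩, -⟩ := (mem_current_mid hR).1 hmsg
            -- The contents come from the sender's state at `j + 1 ≤ k`, hence the strong induction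
            -- over all agents.
            have hlt := (hR.no_creation j i hij).1
            obtain ⟨-, -, rfl⟩ := ready_of_snd R hj
            have h := ih (j + 1) (by omega) (R.agent j)
            exact ⟨h.1, h.2.1⟩
          rw [h2]
          refine ⟨foldr_min_induction (p := (· ∈ Set.range R.input)) hk.1 ?_,
            foldr_max_induction (p := (· ∈ Set.range R.input)) hk.1 ?_,
            foldr_max_induction (p := (· ∈ Set.range R.input)) hk.2.1 ?_⟩ <;>
          · intro b hb
            obtain ⟨msg, hmsg, rfl⟩ := List.mem_map.1 hb
            first | exact (hcur msg hmsg).1 | exact (hcur msg hmsg).2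
        · rw [h2]; exact hk
      · rw [st_of_ne R hv]; exact ih k (by omega) v

/-! ### Rounds -/

theorem half_lt_card_not_faulty (hF : R.FaultyMinority) :
    n / 2 + 1 ≤ {v | ¬ R.Faulty v}.ncard := by
  have h := Set.ncard_add_ncard_compl {v | R.Faulty v}
  rw [Nat.card_eq_fintype_card, Fintype.card_fin] at h
  have h' : 2 * {v | R.Faulty v}.ncard < n := hF
  change n / 2 + 1 ≤ {v | R.Faulty v}ᶜ.ncard
  omega

theorem exists_step_ge {v : Fin n} (hv : ¬ R.Crashes v) (t : ℕ) : ∃ k, t ≤ k ∧ R.agent k = v := by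
  obtain ⟨k, hk, hk'⟩ := Set.Infinite.exists_gt (s := {k | R.agent k = v}) hv t
  exact ⟨k, hk'.le, hk⟩

/-- Every agent that does not crash passes through all rounds. -/
theorem exists_le_round (hR : R.ReliableLinks) (hF : R.FaultyMinority) (r : ℕ) {v : Fin n}
    (hv : ¬ R.Crashes v) : ∃ k, r ≤ (st R k v).round := by
  classical
  induction r generalizing v with
  | zero => exact ⟨0, Nat.zero_le _⟩
  | succ r ih =>
    obtain ⟨t, ht⟩ := ih hv
    have hget : ∀ w, ∃ i, 1 ≤ r → ¬ R.Faulty w → w ≠ v → w ∈ senders R v i r := by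
      intro w
      by_cases hw : 1 ≤ r ∧ ¬ R.Faulty w ∧ w ≠ v
      · obtain ⟨hr, hw, hne⟩ := hw
        obtain ⟨t', ht'⟩ := ih fun h => hw (Or.inl h)
        obtain ⟨j, -, hj, msg, hmsg, hround⟩ := exists_snd_of_le_round R hr ht'
        have hsome : (R.sent j).isSome := Option.isSome_iff_exists.2 ⟨msg, hmsg⟩
        have hem : v ∈ R.emitted j := by
          by_contra hem
          exact hw (Or.inr ⟨j, hj, hsome, v, hne.symm, hem⟩)
        obtain ⟨i, hi, hi'⟩ := hR.no_loss j v hsome (by rw [hj]; exact hne.symm) hem hv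
        exact ⟨i + 1, fun _ _ _ =>
          mem_senders.2 ⟨j, ⟨i, by omega, hi, hi'⟩, hj, msg, hmsg, hround⟩⟩
      · exact ⟨0, fun h1 h2 h3 => (hw ⟨h1, h2, h3⟩).elim⟩
    choose i hi using hget
    -- The sum dominates each deadline `i w`, so for `1 ≤ r` all round-`r` messages of the other
    -- non-faulty agents have arrived by step `k`.
    obtain ⟨k, hk, rfl⟩ := exists_step_ge hv (t + ∑ w, i w)
    refine ⟨k + 1, ?_⟩
    have hk' : r ≤ (st R k (R.agent k)).round := ht.trans (round_mono R _ (by omega))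
    rcases step_cases R k with ⟨-, h2, -⟩ | ⟨hnot, -, -⟩
    · rw [h2]; exact Nat.succ_le_succ hk'
    · by_contra hlt
      have hle := round_mono R (R.agent k) (Nat.le_succ k)
      simp only [Nat.succ_eq_add_one] at hle
      have hr : (st R k (R.agent k)).round = r := by omega
      have hr0 : 1 ≤ r := by
        by_contra h0
        exact hnot (Or.inl (show (st R k (R.agent k)).round = 0 by omega))
      refine hnot (Or.inr ?_)
      rw [length_current_mid hR, hr]
      -- Of at least `n / 2 + 1` non-faulty agents, removing the receiver leaves the `n / 2` that
      -- `Ready` requires.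
      have hsub : {w | ¬ R.Faulty w}.toFinset.erase (R.agent k) ⊆
          senders R (R.agent k) (k + 1) r := by
        intro w hw
        obtain ⟨hne, hw⟩ := Finset.mem_erase.1 hw
        obtain ⟨j, ⟨a, ha, ha'⟩, hj⟩ := mem_senders.1 (hi w hr0 (by simpa using hw) hne)
        have := Finset.single_le_sum (f := i) (fun _ _ => Nat.zero_le _) (Finset.mem_univ w)
        exact mem_senders.2 ⟨j, ⟨a, by omega, ha'⟩, hj⟩
      have h1 := Finset.card_le_card hsub
      have h2 := Finset.pred_card_le_card_erase (s := {w | ¬ R.Faulty w}.toFinset)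
        (a := R.agent k)
      have h3 := half_lt_card_not_faulty hF
      rw [Set.ncard_eq_toFinset_card'] at h3
      omega

/-- In step `j` the agent `v` broadcasts `msg`, the announcement of a round. -/
def Announces (R : Run (algorithm 𝒱 n) n) (j : ℕ) (v : Fin n) (msg : Message 𝒱) : Prop :=
  R.agent j = v ∧ snd R j = some msg

/-- What an agent that enters a new round has received from a majority. -/
theorem exists_majority (hR : R.ReliableLinks) {j : ℕ} {v : Fin n} {msg : Message 𝒱}
    (h : Announces R j v msg) (hr : 2 ≤ msg.round) :
    ∃ H : Finset (Fin n), n / 2 + 1 ≤ H.card ∧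
      (∀ w ∈ H, ∃ i a, Announces R i w a ∧ a.round + 1 = msg.round ∧
        msg.low ≤ a.low ∧ a.low ≤ msg.high ∧ a.high ≤ (st R (j + 1) v).out) ∧
      (∀ b, (∀ i w a, Announces R i w a → a.round + 1 = msg.round → a.low ≤ b) → msg.high ≤ b) ∧
      (∀ b, (∀ i w a, Announces R i w a → a.round + 1 = msg.round → a.high ≤ b) →
        (st R (j + 1) v).out ≤ b) := by
  classical
  obtain ⟨rfl, hsnd⟩ := h
  have hround := round_of_snd R hsnd
  obtain ⟨hready, hst, hmsg⟩ := ready_of_snd R hsnd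
  rw [hst] at hmsg ⊢
  -- The agent's own latest announcement acts as a message to itself; it exists because the round
  -- before the advance is at least 1.
  obtain ⟨i, hi, hiv, hown, -⟩ := exists_latest_snd R (k := j) (v := R.agent j) (by omega)
  have hlow : msg.low = ((mid R j).current.map Message.low).foldr min (mid R j).low := by
    rw [hmsg]; rfl
  have hhigh : msg.high = ((mid R j).current.map Message.low).foldr max (mid R j).low := by
    rw [hmsg]; rfl
  have hout : (mid R j).advance.out =
    ((mid R j).current.map Message.high).foldr max (mid R j).high := rfl
  refine ⟨insert (R.agent j) (senders R (R.agent j) (j + 1) (st R j (R.agent j)).round),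
    ?_, ?_, ?_, ?_⟩
  · rw [Finset.card_insert_of_notMem, ← length_current_mid hR]
    · rcases hready with h0 | h0
      · have : (st R j (R.agent j)).round = 0 := h0
        omega
      · omega
    · intro hmem
      obtain ⟨a, ⟨b, -, hb, hab⟩, ha, -⟩ := mem_senders.1 hmem
      exact (hR.no_creation a b hab).2.1 (ha.trans hb.symm)
  · intro w hw
    rcases Finset.mem_insert.1 hw with rfl | hw
    · refine ⟨i, _, ⟨hiv, hown⟩, hround.symm, ?_, ?_, ?_⟩
      · rw [hlow]; exact foldr_min_le_init _ _
      · rw [hhigh]; exact le_foldr_max_init _ _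
      · rw [hout]; exact le_foldr_max_init _ _
    · obtain ⟨a, ha, haw, b, hb, hbr⟩ := mem_senders.1 hw
      have hmem : b ∈ (mid R j).current := (mem_current_mid hR).2 ⟨⟨a, ha, hb⟩, hbr⟩
      refine ⟨a, b, ⟨haw, hb⟩, by omega, ?_, ?_, ?_⟩
      · rw [hlow]; exact foldr_min_le_of_mem _ (List.mem_map_of_mem hmem)
      · rw [hhigh]; exact le_foldr_max_of_mem _ (List.mem_map_of_mem hmem)
      · rw [hout]; exact le_foldr_max_of_mem _ (List.mem_map_of_mem hmem)
  · intro b hb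
    rw [hhigh]
    refine foldr_max_induction (p := (· ≤ b)) (hb i _ _ ⟨hiv, hown⟩ hround.symm) ?_
    intro c hc
    obtain ⟨a, ha, rfl⟩ := List.mem_map.1 hc
    obtain ⟨⟨t, -, ht⟩, har⟩ := (mem_current_mid hR).1 ha
    exact hb t _ a ⟨rfl, ht⟩ (by omega)
  · intro b hb
    rw [hout]
    refine foldr_max_induction (p := (· ≤ b)) (hb i _ _ ⟨hiv, hown⟩ hround.symm) ?_
    intro c hc
    obtain ⟨a, ha, rfl⟩ := List.mem_map.1 hc
    obtain ⟨⟨t, -, ht⟩, har⟩ := (mem_current_mid hR).1 ha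
    exact hb t _ a ⟨rfl, ht⟩ (by omega)

theorem Announces.unique {i j : ℕ} {v : Fin n} {a b : Message 𝒱} (ha : Announces R i v a)
    (hb : Announces R j v b) (h : a.round = b.round) : i = j ∧ a = b := by
  have hij := snd_unique R ha.2 hb.2 h (ha.1.trans hb.1.symm)
  subst hij
  exact ⟨rfl, Option.some.inj (ha.2.symm.trans hb.2)⟩

theorem inter_nonempty_of_majorities {s t : Finset (Fin n)} (hs : n / 2 + 1 ≤ s.card)
    (ht : n / 2 + 1 ≤ t.card) : ∃ v, v ∈ s ∧ v ∈ t := by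
  classical
  have h1 := Finset.card_union_add_card_inter s t
  have h2 := Finset.card_le_univ (s ∪ t)
  rw [Fintype.card_fin] at h2
  obtain ⟨v, hv⟩ := Finset.card_pos.1 (show 0 < (s ∩ t).card by omega)
  exact ⟨v, Finset.mem_inter.1 hv⟩

/-! ### Agreement -/

/-- Eventually only agents that do not crash announce rounds, and the values `low` are stable. -/
theorem exists_stable_round (hR : R.ReliableLinks) : ∃ (r₀ : ℕ) (f : Fin n → 𝒱), 1 ≤ r₀ ∧
    ∀ j v a, Announces R j v a → r₀ ≤ a.round → ¬ R.Crashes v ∧ a.low = f v := by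
  have hcrash : ∀ v, ∃ s, R.Crashes v → ∀ k, R.agent k = v → k < s := by
    intro v
    by_cases hv : R.Crashes v
    · obtain ⟨s, hs⟩ := hv.bddAbove
      exact ⟨s + 1, fun _ k hk => Nat.lt_succ_of_le (hs hk)⟩
    · exact ⟨0, fun h => (hv h).elim⟩
  have hlow : ∀ v, ∃ s, ∀ k, s ≤ k → (st R k v).low = (st R s v).low := fun v =>
    eventually_const_of_antitone (low_antitone R v) ((Set.finite_range R.input).subset (by
      rintro _ ⟨k, rfl⟩; exact (values_mem_range hR k v).1))
  choose c hc using hcrash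
  choose d hd using hlow
  -- At time `c v + d v` agent `v` has stopped if it crashes, and its `low` is final. As `r₀`
  -- exceeds all rounds at these times, announcements of rounds from `r₀` on come no earlier.
  refine ⟨(∑ v, (st R (c v + d v) v).round) + 1, fun v => (st R (d v) v).low, by omega, ?_⟩
  rintro j v a ⟨rfl, ha⟩ hr
  have h1 := Finset.single_le_sum (f := fun v => (st R (c v + d v) v).round)
    (fun _ _ => Nat.zero_le _) (Finset.mem_univ (R.agent j))
  have h2 := round_succ_of_snd R ha
  have h3 : c (R.agent j) + d (R.agent j) < j + 1 := by
    by_contra hle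
    have := round_mono R (R.agent j) (not_lt.1 hle)
    simp only at this h1
    omega
  refine ⟨fun hcr => ?_, ?_⟩
  · have := hc _ hcr j rfl
    omega
  · obtain ⟨-, -, rfl⟩ := ready_of_snd R ha
    exact hd _ (j + 1) (by omega)

/-- From some round on, all agents output the same value. -/
theorem exists_common_out (hR : R.ReliableLinks) (hF : R.FaultyMinority) :
    ∃ (r₁ : ℕ) (M : 𝒱), ∀ j v a, Announces R j v a → r₁ ≤ a.round →
      (st R (j + 1) v).out = M := by
  classical
  obtain ⟨r₀, f, hr₀, hstable⟩ := exists_stable_round hR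
  let N : Finset (Fin n) := Finset.univ.filter fun v => ¬ R.Crashes v
  have hN : ∀ v, v ∈ N ↔ ¬ R.Crashes v := by simp [N]
  have hNne : N.Nonempty := by
    have h := half_lt_card_not_faulty hF
    obtain ⟨v, hv⟩ := (Set.ncard_pos (Set.toFinite {v | ¬ R.Faulty v})).1 (by omega)
    exact ⟨v, (hN v).2 fun h => hv (Or.inl h)⟩
  obtain ⟨q, hq, hmax⟩ := N.exists_max_image f hNne
  -- some agent is heard of by a majority in each round
  have hpop : ∀ r, r₀ ≤ r → ∃ p ∈ N, ∃ Q : Finset (Fin n), n / 2 + 1 ≤ Q.card ∧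
      ∀ v ∈ Q, ∀ j a, Announces R j v a → a.round = r + 1 → f v ≤ f p ∧ f p ≤ a.high := by
    intro r hr
    have hH : ∀ v, ∃ H : Finset (Fin n), v ∈ N → n / 2 + 1 ≤ H.card ∧ ∀ w ∈ H, w ∈ N ∧
        ∀ j a, Announces R j v a → a.round = r + 1 → f v ≤ f w ∧ f w ≤ a.high := by
      intro v
      by_cases hv : v ∈ N
      · obtain ⟨k, hk⟩ := exists_le_round hR hF (r + 1) ((hN v).1 hv)
        obtain ⟨j, -, hj, msg, hmsg, hround⟩ := exists_snd_of_le_round R (by omega) hk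
        have hann : Announces R j v msg := ⟨hj, hmsg⟩
        obtain ⟨H, hcard, hmem, -, -⟩ := exists_majority hR hann (by omega)
        refine ⟨H, fun _ => ⟨hcard, fun w hw => ?_⟩⟩
        obtain ⟨i, b, hb, hbr, h1, h2, -⟩ := hmem w hw
        have hsb := hstable i w b hb (by omega)
        refine ⟨(hN w).2 hsb.1, fun j' a ha har => ?_⟩
        -- `v` announces round `r + 1` only once, so the chosen `H` speaks for every such
        -- announcement.
        obtain ⟨-, rfl⟩ := ha.unique hann (by omega)
        rw [← hsb.2, ← (hstable j' v a ha (by omega)).2]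
        exact ⟨h1, h2⟩
      · exact ⟨∅, fun h => (hv h).elim⟩
    choose H hH using hH
    obtain ⟨p, hp, hcard⟩ := exists_popular hNne (K := n / 2 + 1) (H := H)
      (fun u hu w hw => ((hH u hu).2 w hw).1) (fun u hu => (hH u hu).1)
    refine ⟨p, hp, _, hcard, fun v hv j a ha har => ?_⟩
    obtain ⟨hvN, hpv⟩ := Finset.mem_filter.1 hv
    exact ((hH v hvN).2 p hpv).2 j a ha har
  -- hence it has the largest stable value
  have htwo : ∀ r, r₀ ≤ r → ∃ p, (∀ j v a, Announces R j v a → a.round = r + 2 →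
      f v ≤ f p ∧ f p ≤ (st R (j + 1) v).out) ∧ f q ≤ f p := by
    intro r hr
    obtain ⟨p, hp, Q, hQ, hQp⟩ := hpop r hr
    have hall : ∀ j v a, Announces R j v a → a.round = r + 2 →
        f v ≤ f p ∧ f p ≤ (st R (j + 1) v).out := by
      intro j v a ha har
      obtain ⟨H, hcard, hmem, -, -⟩ := exists_majority hR ha (by omega)
      -- `w` relays `f p` to `v` through its `high`.
      obtain ⟨w, hwQ, hwH⟩ := inter_nonempty_of_majorities hQ hcard
      obtain ⟨i, b, hb, hbr, h1, -, h3⟩ := hmem w hwH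
      have h4 := hQp w hwQ i b hb (by omega)
      rw [(hstable j v a ha (by omega)).2, (hstable i w b hb (by omega)).2] at h1
      exact ⟨h1.trans h4.1, h4.2.trans h3⟩
    refine ⟨p, hall, ?_⟩
    obtain ⟨k, hk⟩ := exists_le_round hR hF (r + 2) ((hN q).1 hq)
    obtain ⟨j, -, hj, msg, hmsg, hround⟩ := exists_snd_of_le_round R (by omega) hk
    exact (hall j q msg ⟨hj, hmsg⟩ hround).1
  have hhigh : ∀ j v a, Announces R j v a → r₀ + 1 ≤ a.round → a.high ≤ f q := by
    intro j v a ha har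
    obtain ⟨-, -, -, hub, -⟩ := exists_majority hR ha (by omega)
    refine hub _ fun i w b hb hbr => ?_
    have h := hstable i w b hb (by omega)
    rw [h.2]
    exact hmax w ((hN w).2 h.1)
  -- `low` is stable from round `r₀`, `high` is bounded one round later, and the output one round
  -- after that.
  refine ⟨r₀ + 2, f q, fun j v a ha har => le_antisymm ?_ ?_⟩
  · obtain ⟨-, -, -, -, hub⟩ := exists_majority hR ha (by omega)
    exact hub _ fun i w b hb hbr => hhigh i w b hb (by omega)
  · obtain ⟨p, hp, hqp⟩ := htwo (a.round - 2) (by omega)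
    exact hqp.trans (hp j v a ha (by omega)).2

theorem algorithm_solves (𝒱 : Type u) [LinearOrder 𝒱] (n : ℕ) :
    (algorithm 𝒱 n).SolvesStabilizingConsensus n := by
  intro R hR hF
  refine ⟨fun k u => ?_, ?_⟩
  · obtain ⟨v, hv⟩ := (values_mem_range hR k u).2.2
    exact ⟨v, hv.symm⟩
  · obtain ⟨r₁, M, hM⟩ := exists_common_out hR hF
    -- The `+ 1` makes the round positive, so that a latest announcement exists even if `r₁ = 0`.
    have hreach : ∀ v, ∃ k, ¬ R.Crashes v → r₁ + 1 ≤ (st R k v).round := by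
      intro v
      by_cases hv : R.Crashes v
      · exact ⟨0, fun h => (h hv).elim⟩
      · obtain ⟨k, hk⟩ := exists_le_round hR hF (r₁ + 1) hv
        exact ⟨k, fun _ => hk⟩
    choose t ht using hreach
    have hout : ∀ k, ∑ v, t v ≤ k → ∀ v, ¬ R.Crashes v → R.y v k = M := by
      intro k hk v hv
      have h1 := Finset.single_le_sum (f := t) (fun _ _ => Nat.zero_le _) (Finset.mem_univ v)
      have h2 := (ht v hv).trans (round_mono R v (h1.trans hk))
      obtain ⟨j, -, hj, hann, heq⟩ := exists_latest_snd R (k := k) (v := v)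
        (by simp only at h2; omega)
      have h3 := hM j v _ ⟨hj, hann⟩ (show r₁ ≤ (st R k v).round by simp only at h2; omega)
      exact heq.trans h3
    exact ⟨∑ v, t v, fun k hk u v hu hv => by rw [hout k hk v hv, hout _ le_rfl u hu]⟩

end MinMax

theorem mainTheorem6 (𝒱 : Type u) [LinearOrder 𝒱] (n : ℕ) :
    ∃ A : Algorithm 𝒱, A.SolvesStabilizingConsensus n :=
  ⟨MinMax.algorithm 𝒱 n, MinMax.algorithm_solves 𝒱 n⟩
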